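/- Let $R$ be a commutative ring with identity and let $n,d\in\mathbb{N}$. Let the symmetric group $S_d$ act on the $d$-th tensor power $(R^n)^{\otimes d}=R^n\otimes_R\cdots\otimes_R R^n$ by place permutation, $\sigma(v_1\otimes\cdots\otimes v_d)=v_{\sigma^{-1}(1)}\otimes\cdots\otimes v_{\sigma^{-1}(d)}$, extended $R$-linearly to the group algebra $RS_d$, and let $S_R(n,d)=\mathrm{End}_{RS_d}\left((R^n)^{\otimes d}\right)$ be the Schur algebra, i.e. the subalgebra of $\mathrm{End}_R\left((R^n)^{\otimes d}\right)$ of all endomorphisms commuting with the action of $RS_d$. Then the $R$-algebra homomorphism $$\psi\colon RS_d\rightarrow \mathrm{End}_{S_R(n,d)}\left((R^n)^{\otimes d}\right),$$ sending an element of $RS_d$ to its action on $(R^n)^{\otimes d}$, is surjective. -/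

import Mathlib

open scoped TensorProduct

noncomputable section

namespace SchurWeyl

/-- The `d`-th tensor power `(R^n)^{⊗ d}` over `R`. -/
abbrev TensorSpace (R : Type*) [CommRing R] (n d : ℕ) : Type _ :=
  ⨂[R] _i : Fin d, (Fin n → R)

/-- The action of the symmetric group `S_d` on `(R^n)^{⊗ d}` by place permutation. -/
def placePerm (R : Type*) [CommRing R] (n d : ℕ) :
    Representation R (Equiv.Perm (Fin d)) (TensorSpace R n d) where
  toFun σ := (PiTensorProduct.reindex R (fun _ : Fin d => (Fin n → R)) σ).toLinearMap
  map_one' := PiTensorProduct.ext (MultilinearMap.ext fun v =>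
    PiTensorProduct.reindex_tprod (R := R) (1 : Equiv.Perm (Fin d)) v)
  map_mul' σ τ := PiTensorProduct.ext (MultilinearMap.ext fun v => by
    have h1 := PiTensorProduct.reindex_tprod (R := R) (σ * τ) v
    have h2 := PiTensorProduct.reindex_tprod (R := R) τ v
    have h3 := PiTensorProduct.reindex_tprod (R := R) σ (fun i => v (τ.symm i))
    exact h1.trans (h3.symm.trans (congrArg _ h2.symm)))

/-- `σ (v_1 ⊗ ⋯ ⊗ v_d) = v_{σ⁻¹(1)} ⊗ ⋯ ⊗ v_{σ⁻¹(d)}`. -/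
theorem placePerm_tprod (R : Type*) [CommRing R] (n d : ℕ) (σ : Equiv.Perm (Fin d))
    (v : Fin d → Fin n → R) :
    placePerm R n d σ (PiTensorProduct.tprod R v) =
      PiTensorProduct.tprod R (fun i => v (σ⁻¹ i)) :=
  PiTensorProduct.reindex_tprod σ v

/-- The Schur algebra `S_R(n, d) = End_{R S_d}((R^n)^{⊗ d})`: the subalgebra of
`End_R((R^n)^{⊗ d})` of all `R`-endomorphisms commuting with the action of the group algebra
`R S_d`. -/
def schurAlgebra (R : Type*) [CommRing R] (n d : ℕ) :
    Subalgebra R (Module.End R (TensorSpace R n d)) :=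
  Subalgebra.centralizer R (Set.range (placePerm R n d).asAlgebraHom)

theorem schurAlgebra_comm (R : Type*) [CommRing R] (n d : ℕ) (s : schurAlgebra R n d)
    (σ : Equiv.Perm (Fin d)) (x : TensorSpace R n d) :
    placePerm R n d σ (s • x) = s • placePerm R n d σ x := by
  have h := Subalgebra.mem_centralizer_iff R |>.1 s.2 (placePerm R n d σ)
    ⟨MonoidAlgebra.single σ 1, by simp⟩
  exact LinearMap.congr_fun h x

/-- Place permutation by `σ`, as an endomorphism of the `S_R(n, d)`-module `(R^n)^{⊗ d}`. -/
def placePermEnd (R : Type*) [CommRing R] (n d : ℕ) :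
    Equiv.Perm (Fin d) →* Module.End (schurAlgebra R n d) (TensorSpace R n d) where
  toFun σ :=
    { toFun := placePerm R n d σ
      map_add' := map_add _
      map_smul' := fun s x => schurAlgebra_comm R n d s σ x }
  map_one' := by
    ext x
    simp
  map_mul' σ τ := by
    ext x
    simp

/-- The `R`-algebra homomorphism `ψ : R S_d → End_{S_R(n, d)}((R^n)^{⊗ d})`, the `R`-linear
extension of the place permutation action to the group algebra. -/
def psi (R : Type*) [CommRing R] (n d : ℕ) :
    MonoidAlgebra R (Equiv.Perm (Fin d)) →ₐ[R]
      Module.End (schurAlgebra R n d) (TensorSpace R n d) :=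
  MonoidAlgebra.lift R _ _ (placePermEnd R n d)

end SchurWeyl

end

/-! In the basis of words, an endomorphism over the Schur algebra becomes a matrix `M` commuting
with every matrix invariant under simultaneous place permutation. The proof restricts `M` to pairs
of lattice words of equal content, that is, to pairs of standard tableaux of the same shape, and
shows two things over any `R`, with no relation assumed between `n` and `d`.

The restriction is injective (`latticeEntries_injective`): commuting with the raising matrices gives
linear relations among the entries of `M`, and by `eq_zero_of_lattice` these express every entry
through lattice words.

The restriction composed with `psi` is already surjective (`latticeEntries_comp_psi_surjective`):
for each pair, a permutation times a signed column sum gives a vector of entries, and these vectors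
are unitriangular in the lexicographic order. Given `f`, some `a` has the same restricted entries as
`f`, so injectivity gives `psi a = f`. -/

namespace SchurWeyl

/-! ### Raising operators and straightening to lattice words -/

/-- The sum of the letters of a word. -/
def letterSum {n d : ℕ} (j : Fin d → Fin n) : ℕ := ∑ k, (j k : ℕ)

/-- A lattice word: in every prefix, a smaller letter occurs at least as often as a larger one. -/
def IsLattice {n d : ℕ} (j : Fin d → Fin n) : Prop :=
  ∀ r r' : Fin n, r < r' → ∀ t : Fin d,
    (Finset.univ.filter fun k => k ≤ t ∧ j k = r').card ≤
      (Finset.univ.filter fun k => k ≤ t ∧ j k = r).card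

/-- `w` arises from `u` by changing some letters `r` to `r'`. -/
def Raises {n d : ℕ} (r r' : Fin n) (w u : Fin d → Fin n) : Prop :=
  ∀ k, w k = u k ∨ (u k = r ∧ w k = r')

instance {n d : ℕ} (r r' : Fin n) (w u : Fin d → Fin n) : Decidable (Raises r r' w u) := by
  unfold Raises; infer_instance

/-- Möbius inversion over the subsets of `U`: if `G` is supported on `m`-subsets and its sums over
the supersets of every smaller set vanish, then so does its sum over the subsets of `A`, as soon as
`U \ A` has fewer than `m` elements. -/
theorem sum_powerset_eq_zero_of_sum_superset_eq_zero {ι R : Type*} [DecidableEq ι] [CommRing R]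
    (U A : Finset ι) (hA : A ⊆ U) (m : ℕ) (hm : (U \ A).card < m) (G : Finset ι → R)
    (hG : ∀ D, D ⊆ U → D.card ≠ m → G D = 0)
    (hB : ∀ B, B ⊆ U → B.card < m → ∑ D ∈ U.powerset, (if B ⊆ D then G D else 0) = 0) :
    ∑ B ∈ A.powerset, G B = 0 := by
  -- The alternating sum over `B` is evaluated twice: here only `D = B` with `m` elements survives;
  -- in `h2` only `D` disjoint from `A` survives, and such `D` are too small to support `G`.
  have h1 : ∀ B ∈ A.powerset,
      (-1 : R) ^ B.card * ∑ D ∈ U.powerset, (if B ⊆ D then G D else 0) = (-1) ^ m * G B := by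
    intro B hBA
    have hBU : B ⊆ U := (Finset.mem_powerset.1 hBA).trans hA
    rcases lt_trichotomy B.card m with h | h | h
    · rw [hB B hBU h, hG B hBU h.ne, mul_zero, mul_zero]
    · rw [h]
      congr 1
      rw [Finset.sum_eq_single B]
      · simp
      · intro D hD hDB
        split_ifs with hs
        · refine hG D (Finset.mem_powerset.1 hD) fun hc => hDB ?_
          exact (Finset.eq_of_subset_of_card_le hs (by omega)).symm
        · rfl
      · intro hn
        exact absurd (Finset.mem_powerset.2 hBU) hn
    · rw [hG B hBU h.ne', mul_zero, Finset.sum_eq_zero, mul_zero]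
      intro D hD
      split_ifs with hs
      · have := Finset.card_le_card hs
        exact hG D (Finset.mem_powerset.1 hD) (by omega)
      · rfl
  have h2 : ∑ B ∈ A.powerset,
      (-1 : R) ^ B.card * ∑ D ∈ U.powerset, (if B ⊆ D then G D else 0) = 0 := by
    simp_rw [Finset.mul_sum]
    rw [Finset.sum_comm]
    refine Finset.sum_eq_zero fun D hD => ?_
    have hDU := Finset.mem_powerset.1 hD
    have h3 : ∑ B ∈ A.powerset, (-1 : R) ^ B.card * (if B ⊆ D then G D else 0) =
        (∑ B ∈ (A ∩ D).powerset, (-1 : R) ^ B.card) * G D := by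
      rw [Finset.sum_mul]
      have : (A ∩ D).powerset = A.powerset.filter (fun B => B ⊆ D) := by
        ext B
        rw [Finset.mem_powerset, Finset.mem_filter, Finset.mem_powerset, Finset.subset_inter_iff]
      rw [this, Finset.sum_filter]
      exact Finset.sum_congr rfl fun B _ => by split_ifs <;> simp
    rw [h3]
    by_cases he : A ∩ D = ∅
    · have : D ⊆ U \ A := fun x hx => Finset.mem_sdiff.2
        ⟨hDU hx, fun hxA => by
          have : x ∈ A ∩ D := Finset.mem_inter.2 ⟨hxA, hx⟩
          simp [he] at this⟩
      have := Finset.card_le_card this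
      rw [hG D hDU (by omega), mul_zero]
    · have h4 := Finset.sum_powerset_neg_one_pow_card_of_nonempty (Finset.nonempty_iff_ne_empty.2 he)
      have h5 : ∑ B ∈ (A ∩ D).powerset, (-1 : R) ^ B.card = 0 := by
        exact_mod_cast congrArg (Int.cast : ℤ → R) h4
      rw [h5, zero_mul]
  rw [Finset.sum_congr rfl h1, ← Finset.mul_sum] at h2
  have h6 : (-1 : R) ^ m * (-1) ^ m = 1 := by rw [← mul_pow]; simp
  calc _ = (-1 : R) ^ m * ((-1) ^ m * ∑ B ∈ A.powerset, G B) := by rw [← mul_assoc, h6, one_mul]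
    _ = 0 := by rw [h2, mul_zero]

/-- The word that is `r'` on `D`, `r` on `U \ D`, and `j` elsewhere. -/
def fillWord {n d : ℕ} (j : Fin d → Fin n) (r r' : Fin n) (U D : Finset (Fin d)) :
    Fin d → Fin n :=
  fun k => if k ∈ U then (if k ∈ D then r' else r) else j k

theorem letterSum_fillWord {n d : ℕ} (j : Fin d → Fin n) {r r' : Fin n} (hr : r < r')
    {U D : Finset (Fin d)} (hD : D ⊆ U) :
    letterSum (fillWord j r r' U D) =
      letterSum (fillWord j r r' U ∅) + D.card * ((r' : ℕ) - r) := by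
  have h : ∀ k, (fillWord j r r' U D k : ℕ) =
      fillWord j r r' U ∅ k + if k ∈ D then ((r' : ℕ) - r) else 0 := by
    intro k
    have hr' : (r : ℕ) < r' := hr
    by_cases hk : k ∈ D
    · have := hD hk
      simp [fillWord, hk, this]; omega
    · simp [fillWord, hk]
  unfold letterSum
  rw [Finset.sum_congr rfl fun k _ => h k, Finset.sum_add_distrib]
  simp

/-- Since `U` contains every `r` of `j`, the letters `r` of the filled word are exactly those on `U
\ B`, so a raising amounts to a choice of `D ⊇ B`. This turns superset sums into raising relations.
-/
theorem sum_raises_fillWord {n d : ℕ} {R : Type*} [CommRing R] (j : Fin d → Fin n) {r r' : Fin n}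
    (hr : r < r') {U B : Finset (Fin d)} (hU : ∀ k, j k = r → k ∈ U) (hB : B ⊆ U)
    (g : (Fin d → Fin n) → R) :
    ∑ D ∈ U.powerset, (if B ⊆ D then g (fillWord j r r' U D) else 0) =
      ∑ w, if Raises r r' w (fillWord j r r' U B) then g w else 0 := by
  rw [← Finset.sum_filter, ← Finset.sum_filter]
  refine Finset.sum_bij' (fun D _ => fillWord j r r' U D)
    (fun w _ => U.filter fun k => w k = r') ?_ ?_ ?_ ?_ ?_
  · intro D hD
    simp only [Finset.mem_filter, Finset.mem_powerset, Finset.mem_univ, true_and] at hD ⊢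
    intro k
    by_cases hk : k ∈ U <;> by_cases hkB : k ∈ B
    · simp [fillWord, hk, hkB, hD.2 hkB]
    · by_cases hkD : k ∈ D <;> simp [fillWord, hk, hkB, hkD]
    · exact absurd (hB hkB) hk
    · simp [fillWord, hk]
  · intro w hw
    simp only [Finset.mem_filter, Finset.mem_powerset, Finset.mem_univ, true_and] at hw ⊢
    refine ⟨Finset.filter_subset _ _, fun k hk => ?_⟩
    have hkU := hB hk
    rcases hw k with h | h
    · simp [hkU, h, fillWord, hk]
    · simp [hkU, h.2]
  · intro D hD
    simp only [Finset.mem_filter, Finset.mem_powerset] at hD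
    ext k
    simp only [Finset.mem_filter]
    constructor
    · rintro ⟨hk, h⟩
      by_contra hkD
      simp [fillWord, hk, hkD, hr.ne] at h
    · intro hk
      have := hD.1 hk
      simp [fillWord, hk, this]
  · intro w hw
    simp only [Finset.mem_filter, Finset.mem_univ, true_and] at hw
    funext k
    have h := hw k
    by_cases hk : k ∈ U
    · by_cases hw' : w k = r'
      · simp [fillWord, hk, hw']
      · by_cases hkB : k ∈ B
        · simp [fillWord, hk, hkB, hw'] at h
        · simp [fillWord, hk, hkB, hw'] at h
          simp only [fillWord, hk, if_true, Finset.mem_filter, true_and, hw', if_false]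
          tauto
    · have hj : j k ≠ r := fun h => hk (hU k h)
      simp [fillWord, hk, hj] at h
      simp [fillWord, hk, h]
  · intro D _
    rfl

/-- Straightening to lattice words: a function on words of letter sum `s` is determined by its
values on lattice words if it vanishes on the image of all raising operators. -/
theorem eq_zero_of_lattice {n d : ℕ} {R : Type*} [CommRing R] (s : ℕ)
    (g : (Fin d → Fin n) → R) (hs : ∀ w, letterSum w ≠ s → g w = 0)
    (hraise : ∀ r r' u, letterSum u < s → ∑ w, (if Raises r r' w u then g w else 0) = 0)
    (hlat : ∀ w, IsLattice w → g w = 0) (j : Fin d → Fin n) : g j = 0 := by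
  have key : ∀ j : Lex (Fin d → Fin n), g (ofLex j) = 0 := by
    intro j
    induction j using WellFoundedLT.induction with
    | ind j ih =>
    by_cases hj : IsLattice (ofLex j)
    · exact hlat _ hj
    by_cases hjs : letterSum (ofLex j) = s
    swap
    · exact hs _ hjs
    unfold IsLattice at hj
    push Not at hj
    obtain ⟨r, r', hr, t, hlt⟩ := hj
    set i : Fin d → Fin n := ofLex j with hi
    -- At the violated prefix, `P` has fewer elements than `A`. Möbius inversion with `A ∪ Q` in `U`
    -- therefore applies and yields a relation that keeps all of `P` at `r`.
    set A := Finset.univ.filter fun k => k ≤ t ∧ i k = r' with hA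
    set P := Finset.univ.filter fun k => k ≤ t ∧ i k = r with hP
    set Q := Finset.univ.filter fun k => t < k ∧ i k = r with hQ
    set U := A ∪ Q ∪ P with hU
    have hfill : fillWord i r r' U A = i := by
      funext k
      by_cases hkA : k ∈ A
      · have hkU : k ∈ U := by simp [hU, hkA]
        simp only [fillWord, hkU, hkA, if_true]
        simp only [hA, Finset.mem_filter] at hkA
        exact hkA.2.2.symm
      · by_cases hkU : k ∈ U
        · simp only [fillWord, hkU, hkA, if_true, if_false]
          simp only [hU, Finset.mem_union, hkA, false_or] at hkU
          rcases hkU with h | h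
          · simp only [hQ, Finset.mem_filter] at h
            exact h.2.2.symm
          · simp only [hP, Finset.mem_filter] at h
            exact h.2.2.symm
        · simp [fillWord, hkU]
    have hAU : A ⊆ U := fun k hk => by simp [hU, hk]
    have hpos : 0 < (r' : ℕ) - r := by have : (r : ℕ) < r' := hr; omega
    have hsumA := letterSum_fillWord i hr hAU
    rw [hfill, hjs] at hsumA
    have hsum := sum_powerset_eq_zero_of_sum_superset_eq_zero U (A ∪ Q)
      Finset.subset_union_left A.card
      (by
        refine lt_of_le_of_lt (Finset.card_le_card ?_) hlt
        intro k hk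
        simp only [hU, Finset.mem_sdiff, Finset.mem_union] at hk
        tauto)
      (fun D => g (fillWord i r r' U D))
      (fun D hD hc => hs _ fun h => hc (by
        have := letterSum_fillWord i hr hD
        exact Nat.eq_of_mul_eq_mul_right hpos (by omega)))
      (fun B hB hc => by
        rw [sum_raises_fillWord i hr (fun k hk => by
          rcases le_or_gt k t with h | h
          · simp [hU, hP, h, hk]
          · simp [hU, hQ, h, hk]) hB g]
        refine hraise _ _ _ ?_
        have := letterSum_fillWord i hr hB
        have := Nat.mul_lt_mul_of_pos_right hc hpos
        omega)
    rw [Finset.sum_eq_single A] at hsum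
    · simpa only [hfill] using hsum
    · intro B hB hBA
      have hBQ := Finset.mem_powerset.1 hB
      have hBU : B ⊆ U := hBQ.trans Finset.subset_union_left
      by_cases hc : B.card = A.card
      swap
      · refine hs _ fun h => hc ?_
        have := letterSum_fillWord i hr hBU
        exact Nat.eq_of_mul_eq_mul_right hpos (by omega)
      -- The other terms are lexicographically smaller: at the first position of `A \ B` the letter
      -- drops from `r'` to `r`, and nothing earlier changes because `Q` lies after `t`.
      have hne : (A \ B).Nonempty := by
        rw [Finset.sdiff_nonempty]
        exact fun h => hBA (Finset.eq_of_subset_of_card_le h hc.le).symm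
      refine ih (toLex (fillWord i r r' U B)) ?_
      refine ⟨(A \ B).min' hne, fun k hk => ?_, ?_⟩
      · have hmem := Finset.min'_mem _ hne
        set a := (A \ B).min' hne with ha
        have hat : a ≤ t := by
          have := (Finset.mem_sdiff.1 hmem).1
          simp only [hA, Finset.mem_filter] at this
          exact this.2.1
        have hkAB : k ∈ B ↔ k ∈ A := by
          constructor
          · intro h
            rcases Finset.mem_union.1 (hBQ h) with h' | h'
            · exact h'
            · simp only [hQ, Finset.mem_filter] at h'
              exact absurd (hk.trans_le hat) (not_lt.2 h'.2.1.le)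
          · intro h
            by_contra h'
            exact absurd (Finset.min'_le _ k (Finset.mem_sdiff.2 ⟨h, h'⟩)) (not_le.2 hk)
        change fillWord i r r' U B k = i k
        rw [← congrFun hfill k]
        simp only [fillWord, hkAB]
      · have hmem := Finset.mem_sdiff.1 (Finset.min'_mem _ hne)
        set a := (A \ B).min' hne with ha
        change fillWord i r r' U B a < i a
        rw [← congrFun hfill a]
        simp only [fillWord, hAU hmem.1, hmem.1, hmem.2, if_true, if_false]
        exact hr
    · intro h
      exact absurd (Finset.mem_powerset.2 Finset.subset_union_left) h
  exact key (toLex j)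

/-! ### Matrices commuting with the invariants -/

/-- The matrix `M`, indexed by words, commutes with all matrices that are invariant under
simultaneous place permutation of rows and columns. -/
def CommutesWithInvariants {n d : ℕ} {R : Type*} [CommRing R]
    (M : Matrix (Fin d → Fin n) (Fin d → Fin n) R) : Prop :=
  ∀ X : Matrix (Fin d → Fin n) (Fin d → Fin n) R,
    (∀ (σ : Equiv.Perm (Fin d)) i j, X (i ∘ σ) (j ∘ σ) = X i j) → M * X = X * M

theorem CommutesWithInvariants.transpose {n d : ℕ} {R : Type*} [CommRing R]
    {M : Matrix (Fin d → Fin n) (Fin d → Fin n) R} (hM : CommutesWithInvariants M) :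
    CommutesWithInvariants M.transpose := by
  intro X hX
  have := hM X.transpose fun σ i j => hX σ j i
  apply Matrix.transpose_injective
  rw [Matrix.transpose_mul, Matrix.transpose_mul, Matrix.transpose_transpose, this]

theorem CommutesWithInvariants.sub {n d : ℕ} {R : Type*} [CommRing R]
    {M N : Matrix (Fin d → Fin n) (Fin d → Fin n) R} (hM : CommutesWithInvariants M)
    (hN : CommutesWithInvariants N) : CommutesWithInvariants (M - N) := by
  intro X hX
  rw [sub_mul, mul_sub, hM X hX, hN X hX]

/-- The diagonal idempotent of a level set of `ν` is an invariant matrix, so `M` is block diagonal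
along `ν`. -/
theorem CommutesWithInvariants.apply_eq_zero {n d : ℕ} {R : Type*} [CommRing R]
    {M : Matrix (Fin d → Fin n) (Fin d → Fin n) R} (hM : CommutesWithInvariants M)
    {α : Type*} [DecidableEq α] (ν : (Fin d → Fin n) → α)
    (hν : ∀ (σ : Equiv.Perm (Fin d)) j, ν (j ∘ σ) = ν j) {i j : Fin d → Fin n}
    (h : ν i ≠ ν j) : M i j = 0 := by
  have := hM (Matrix.diagonal fun k => if ν k = ν j then 1 else 0) (fun σ i j => by
    have : i ∘ σ = j ∘ σ ↔ i = j := σ.surjective.injective_comp_right.eq_iff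
    simp [Matrix.diagonal_apply, this, hν])
  have := congrFun (congrFun this i) j
  simpa [Matrix.mul_diagonal, Matrix.diagonal_mul, h] using this

theorem letterSum_comp {n d : ℕ} (σ : Equiv.Perm (Fin d)) (j : Fin d → Fin n) :
    letterSum (j ∘ σ) = letterSum j :=
  Equiv.sum_comp σ fun k => (j k : ℕ)

theorem CommutesWithInvariants.sum_raises {n d : ℕ} {R : Type*} [CommRing R]
    {M : Matrix (Fin d → Fin n) (Fin d → Fin n) R} (hM : CommutesWithInvariants M)
    (r r' : Fin n) (u : Fin d → Fin n) (hu : ∀ i, M i u = 0) (i : Fin d → Fin n) :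
    ∑ w, (if Raises r r' w u then M i w else 0) = 0 := by
  have := hM (Matrix.of fun w u => if Raises r r' w u then 1 else 0) (fun σ i j => by
    have : Raises r r' (i ∘ σ) (j ∘ σ) ↔ Raises r r' i j :=
      ⟨fun h k => by simpa using h (σ.symm k), fun h k => h (σ k)⟩
    simp [this])
  have := congrFun (congrFun this i) u
  simpa [Matrix.mul_apply, hu] using this

theorem CommutesWithInvariants.eq_zero {n d : ℕ} {R : Type*} [CommRing R]
    {M : Matrix (Fin d → Fin n) (Fin d → Fin n) R} (hM : CommutesWithInvariants M)
    (hlat : ∀ i j, IsLattice i → IsLattice j → M i j = 0) : M = 0 := by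
  have hdiff : ∀ i j, letterSum i ≠ letterSum j → M i j = 0 := fun i j h =>
    hM.apply_eq_zero letterSum letterSum_comp h
  have key : ∀ s, ∀ i j, letterSum j = s → M i j = 0 := by
    intro s
    induction s using Nat.strong_induction_on with
    | _ s ih =>
    -- Straightening is applied first to the row index, through the transpose, and then to the
    -- column index; the raising relations come from the vanishing blocks of smaller letter sum.
    have hcol : ∀ i j, IsLattice j → letterSum j = s → M i j = 0 := by
      intro i j hj hjs
      refine eq_zero_of_lattice s (fun w => M.transpose j w)
        (fun w hw => hdiff _ _ (by rwa [hjs])) ?_ (fun w hw => hlat w j hw hj) i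
      intro r r' u hu
      refine hM.transpose.sum_raises r r' u (fun k => ?_) j
      by_cases h : letterSum k = letterSum u
      · exact ih _ hu u k h
      · exact hdiff _ _ (Ne.symm h)
    intro i j hjs
    by_cases his : letterSum i = s
    swap
    · exact hdiff _ _ (by rwa [hjs])
    refine eq_zero_of_lattice s (M i) (fun w hw => hdiff _ _ (by rw [his]; exact Ne.symm hw)) ?_ ?_ j
    · intro r r' u hu
      exact hM.sum_raises r r' u (fun k => ih _ hu k u rfl) i
    · intro w hw
      by_cases h : letterSum w = s
      · exact hcol i w hw h
      · exact hdiff _ _ (by rw [his]; exact Ne.symm h)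
  ext i j
  exact key _ i j rfl


/-! ### Columns of words and lexicographic minimality -/

/-- The number of earlier occurrences of the `k`-th letter of `j`: the column containing `k` in the
tableau whose `r`-th row consists of the positions of the letter `r`. -/
def colIdx {n d : ℕ} (j : Fin d → Fin n) (k : Fin d) : ℕ :=
  (Finset.univ.filter fun l => l < k ∧ j l = j k).card

theorem colIdx_lt_colIdx {n d : ℕ} {j : Fin d → Fin n} {k l : Fin d} (h : j k = j l)
    (hkl : k < l) : colIdx j k < colIdx j l := by
  refine Finset.card_lt_card ((Finset.ssubset_iff_of_subset ?_).2 ⟨k, ?_, ?_⟩)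
  · intro x hx
    simp only [Finset.mem_filter, Finset.mem_univ, true_and] at hx ⊢
    exact ⟨hx.1.trans hkl, hx.2.trans h⟩
  · simp [hkl, h]
  · simp

theorem eq_of_colIdx_eq {n d : ℕ} {j : Fin d → Fin n} {k l : Fin d} (h : j k = j l)
    (hc : colIdx j k = colIdx j l) : k = l := by
  rcases lt_trichotomy k l with hkl | hkl | hkl
  · exact absurd hc (colIdx_lt_colIdx h hkl).ne
  · exact hkl
  · exact absurd hc (colIdx_lt_colIdx h.symm hkl).ne'

theorem exists_colIdx_eq {n d : ℕ} (j : Fin d → Fin n) (S : Finset (Fin d))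
    (hS : ∀ k ∈ S, ∀ l < k, l ∈ S) (r : Fin n) (c : ℕ)
    (hc : c < (S.filter fun k => j k = r).card) :
    ∃ k ∈ S, j k = r ∧ colIdx j k = c := by
  obtain ⟨k, hk, h⟩ := Finset.surj_on_of_inj_on_of_card_le
    (s := S.filter fun k => j k = r) (t := Finset.range (S.filter fun k => j k = r).card)
    (fun k _ => colIdx j k)
    (fun k hk => by
      simp only [Finset.mem_filter] at hk
      refine Finset.mem_range.2 (Finset.card_lt_card
        ((Finset.ssubset_iff_of_subset ?_).2 ⟨k, ?_, ?_⟩))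
      · intro x hx
        simp only [Finset.mem_filter, Finset.mem_univ, true_and] at hx ⊢
        exact ⟨hS k hk.1 x hx.1, hx.2.trans hk.2⟩
      · simp [hk]
      · simp)
    (fun k l hk hl h => by
      simp only [Finset.mem_filter] at hk hl
      exact eq_of_colIdx_eq (hk.2.trans hl.2.symm) h)
    (by simp) c (Finset.mem_range.2 hc)
  simp only [Finset.mem_filter] at hk
  exact ⟨k, hk.1, hk.2, h.symm⟩

/-- The multiplicities of the letters of a word. -/
def content {n d : ℕ} (j : Fin d → Fin n) (r : Fin n) : ℕ :=
  (Finset.univ.filter fun k => j k = r).card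

theorem content_comp {n d : ℕ} (σ : Equiv.Perm (Fin d)) (j : Fin d → Fin n) :
    content (j ∘ σ) = content j := by
  funext r
  refine Finset.card_bij (fun k _ => σ k) ?_ ?_ ?_
  · intro k hk
    simpa using hk
  · intro k _ l _ h
    exact σ.injective h
  · intro k hk
    exact ⟨σ.symm k, by simpa using hk, by simp⟩

/-- A position is determined by its letter and column, and the content determines which such pairs
occur. -/
theorem exists_perm_of_content_eq {n d : ℕ} {i j : Fin d → Fin n} (h : content i = content j) :
    ∃ p : Equiv.Perm (Fin d), (∀ k, i (p k) = j k) ∧ ∀ k, colIdx i (p k) = colIdx j k := by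
  have hex : ∀ k, ∃ l, i l = j k ∧ colIdx i l = colIdx j k := by
    intro k
    obtain ⟨l, -, hl⟩ := exists_colIdx_eq i Finset.univ (by simp) (j k) (colIdx j k) (by
      change _ < content i (j k)
      rw [h]
      refine Finset.card_lt_card ((Finset.ssubset_iff_of_subset ?_).2 ⟨k, ?_, ?_⟩)
      · intro x hx
        simp only [Finset.mem_filter, Finset.mem_univ, true_and] at hx ⊢
        exact hx.2
      · simp
      · simp)
    exact ⟨l, hl⟩
  choose p hp hc using hex
  have hinj : Function.Injective p := fun k l hkl =>
    eq_of_colIdx_eq (j := j) (by rw [← hp, ← hp, hkl]) (by rw [← hc, ← hc, hkl])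
  exact ⟨Equiv.ofBijective p (Finite.injective_iff_bijective.1 hinj), hp, hc⟩

/-- Up to and including `k` the letter `j k` occurs `colIdx j k + 1` times, hence `r` occurs at
least as often. The columns of the tableau are thus standard. -/
theorem IsLattice.exists_lt {n d : ℕ} {j : Fin d → Fin n} (hj : IsLattice j) {k : Fin d}
    {r : Fin n} (hr : r < j k) : ∃ l < k, j l = r ∧ colIdx j l = colIdx j k := by
  obtain ⟨l, hl, h1, h2⟩ := exists_colIdx_eq j (Finset.univ.filter fun l => l ≤ k)
    (by
      intro a ha b hb
      simp only [Finset.mem_filter, Finset.mem_univ, true_and] at ha ⊢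
      exact hb.le.trans ha) r (colIdx j k) (by
      rw [Finset.filter_filter]
      refine lt_of_lt_of_le ?_ (hj r (j k) hr k)
      refine Finset.card_lt_card ((Finset.ssubset_iff_of_subset ?_).2 ⟨k, ?_, ?_⟩)
      · intro x hx
        simp only [Finset.mem_filter, Finset.mem_univ, true_and] at hx ⊢
        exact ⟨hx.1.le, hx.2⟩
      · simp
      · simp)
  simp only [Finset.mem_filter, Finset.mem_univ, true_and] at hl
  refine ⟨l, lt_of_le_of_ne hl ?_, h1, h2⟩
  rintro rfl
  exact hr.ne' h1

/-- `w` has no repeated letters in the columns of `j`. -/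
def ColumnInjective {n d : ℕ} (j w : Fin d → Fin n) : Prop :=
  ∀ k l, colIdx j k = colIdx j l → w k = w l → k = l

/-- If `w` first drops below `j` at `k`, the letter `w k` already occurs in `j`, hence in `w`,
earlier in the same column. -/
theorem IsLattice.toLex_le {n d : ℕ} {j w : Fin d → Fin n} (hj : IsLattice j)
    (hw : ColumnInjective j w) : toLex j ≤ toLex w := by
  by_contra h
  obtain ⟨k, hlt, hk⟩ := not_le.1 h
  obtain ⟨l, hl, h1, h2⟩ := hj.exists_lt hk
  have h3 : w l = j l := hlt l hl
  exact hl.ne (hw l k h2 (h3.trans h1))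

/-! ### Signed column sums and unitriangularity -/

/-- The column stabilizer of a word. -/
def colStabilizer {n d : ℕ} (j : Fin d → Fin n) : Finset (Equiv.Perm (Fin d)) :=
  Finset.univ.filter fun c => ∀ k, colIdx j (c k) = colIdx j k

/-- A matrix entry of the signed column sum of `j` followed by the permutation `p`. -/
def signedColumnEntry (R : Type*) [CommRing R] {n d : ℕ} (p : Equiv.Perm (Fin d))
    (j v w : Fin d → Fin n) : R :=
  ∑ c ∈ colStabilizer j, if v ∘ (p * c) = w then ((Equiv.Perm.sign c : ℤ) : R) else 0

/-- A transposition within a column that fixes `w` cancels the terms in pairs of opposite sign. -/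
theorem columnInjective_of_signedColumnEntry_ne_zero {R : Type*} [CommRing R] {n d : ℕ}
    {p : Equiv.Perm (Fin d)} {j v w : Fin d → Fin n} (h : signedColumnEntry R p j v w ≠ 0) :
    ColumnInjective j w := by
  intro k l hkl hw
  by_contra hne
  refine h ?_
  have hws : w ∘ Equiv.swap k l = w := by
    funext x
    simp only [Function.comp_apply, Equiv.swap_apply_def]
    split_ifs with h1 h2
    · rw [h1, hw]
    · rw [h2, hw]
    · rfl
  have hcs : ∀ x, colIdx j (Equiv.swap k l x) = colIdx j x := by
    intro x
    simp only [Equiv.swap_apply_def]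
    split_ifs with h1 h2
    · rw [h1, hkl]
    · rw [h2, hkl]
    · rfl
  refine Finset.sum_involution (fun c _ => c * Equiv.swap k l) ?_ ?_ ?_ ?_
  · intro c _
    have : v ∘ ⇑(p * (c * Equiv.swap k l)) = w ↔ v ∘ ⇑(p * c) = w := by
      have h1 : v ∘ ⇑(p * (c * Equiv.swap k l)) = (v ∘ ⇑(p * c)) ∘ ⇑(Equiv.swap k l) := rfl
      rw [h1]
      nth_rewrite 1 [← hws]
      exact (Equiv.surjective _).injective_comp_right.eq_iff
    simp only [this]
    split_ifs
    · simp [Equiv.Perm.sign_mul, Equiv.Perm.sign_swap hne]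
    · simp
  · intro c _ _ hc
    have : Equiv.swap k l = 1 := by simpa using hc
    exact hne (Equiv.swap_eq_one_iff.1 this)
  · intro c hc
    simp only [colStabilizer, Finset.mem_filter, Finset.mem_univ, true_and] at hc ⊢
    intro x
    rw [Equiv.Perm.mul_apply, hc, hcs]
  · intro c _
    simp [mul_assoc]

/-- A nonzero term gives `v ∘ (p * c) = w`, and `p * c` carries the columns of `j` to those of `i`.
-/
theorem columnInjective_left_of_signedColumnEntry_ne_zero {R : Type*} [CommRing R] {n d : ℕ}
    {p : Equiv.Perm (Fin d)} {i j v w : Fin d → Fin n}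
    (hp : ∀ k, colIdx i (p k) = colIdx j k) (h : signedColumnEntry R p j v w ≠ 0) :
    ColumnInjective i v := by
  have hw := columnInjective_of_signedColumnEntry_ne_zero h
  obtain ⟨c, hc, h0⟩ := Finset.exists_ne_zero_of_sum_ne_zero h
  have hv : v ∘ ⇑(p * c) = w := by
    by_contra hv
    exact h0 (if_neg hv)
  simp only [colStabilizer, Finset.mem_filter, Finset.mem_univ, true_and] at hc
  intro k l hkl hvkl
  obtain ⟨a, rfl⟩ := (p * c).surjective k
  obtain ⟨b, rfl⟩ := (p * c).surjective l
  refine congrArg _ (hw a b ?_ ?_)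
  · simpa only [Equiv.Perm.mul_apply, hp, hc] using hkl
  · rw [← hv]
    exact hvkl

/-- A contributing `c` preserves both letters and columns of `j`, so only `c = 1` remains. -/
theorem signedColumnEntry_self {R : Type*} [CommRing R] {n d : ℕ}
    {p : Equiv.Perm (Fin d)} {i j : Fin d → Fin n} (hij : ∀ k, i (p k) = j k) :
    signedColumnEntry R p j i j = 1 := by
  unfold signedColumnEntry
  rw [Finset.sum_eq_single 1]
  · have : i ∘ ⇑p = j := funext hij
    simp [this]
  · intro c hc hc1
    simp only [colStabilizer, Finset.mem_filter, Finset.mem_univ, true_and] at hc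
    refine if_neg fun h => hc1 (Equiv.ext fun k => ?_)
    refine eq_of_colIdx_eq (j := j) ?_ (hc k)
    rw [← hij]
    exact congrFun h k
  · intro h
    simp [colStabilizer] at h

/-- A unitriangular family of vectors spans. -/
theorem eq_top_of_unitriangular {K R : Type*} [Finite K] [PartialOrder K] [CommRing R]
    (v : K → K → R) (hdiag : ∀ k, v k k = 1) (htri : ∀ k l, v k l ≠ 0 → k ≤ l)
    (M : Submodule R (K → R)) (hv : ∀ k, v k ∈ M) : M = ⊤ := by
  classical
  have := Fintype.ofFinite K
  have hsingle : ∀ k : K, Pi.single k (1 : R) ∈ M := by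
    intro k
    induction k using WellFoundedGT.induction with
    | ind k ih =>
    have h : v k = Pi.single k 1 + ∑ l ∈ Finset.univ.erase k, v k l • Pi.single l (1 : R) := by
      rw [← hdiag k]
      conv_lhs => rw [← Finset.univ_sum_single (v k)]
      rw [← Finset.add_sum_erase _ _ (Finset.mem_univ k)]
      congr 1
      refine Finset.sum_congr rfl fun l _ => ?_
      rw [hdiag k, ← Pi.single_smul, smul_eq_mul, mul_one]
    rw [eq_sub_of_add_eq h.symm]
    refine M.sub_mem (hv k) (M.sum_mem fun l hl => ?_)
    by_cases h0 : v k l = 0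
    · simp [h0]
    · exact M.smul_mem _ (ih l (lt_of_le_of_ne (htri k l h0) (Finset.ne_of_mem_erase hl).symm))
  rw [eq_top_iff]
  intro x _
  rw [← Finset.univ_sum_single x]
  refine M.sum_mem fun k _ => ?_
  have : Pi.single k (x k) = x k • Pi.single k (1 : R) := by
    rw [← Pi.single_smul, smul_eq_mul, mul_one]
  rw [this]
  exact M.smul_mem _ (hsingle k)

/-! ### From endomorphisms to matrices -/

/-- The basis of the tensor power indexed by words. -/
noncomputable def wordBasis (R : Type*) [CommRing R] (n d : ℕ) :
    Module.Basis (Fin d → Fin n) R (TensorSpace R n d) :=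
  Basis.piTensorProduct fun _ => Pi.basisFun R (Fin n)

theorem placePerm_wordBasis (R : Type*) [CommRing R] (n d : ℕ) (σ : Equiv.Perm (Fin d))
    (j : Fin d → Fin n) :
    placePerm R n d σ (wordBasis R n d j) = wordBasis R n d (j ∘ ⇑σ⁻¹) := by
  simp only [wordBasis, Basis.piTensorProduct_apply, placePerm_tprod]
  rfl

theorem toLin_mem_schurAlgebra (R : Type*) [CommRing R] (n d : ℕ)
    (X : Matrix (Fin d → Fin n) (Fin d → Fin n) R)
    (hX : ∀ (σ : Equiv.Perm (Fin d)) i j, X (i ∘ σ) (j ∘ σ) = X i j) :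
    Matrix.toLin (wordBasis R n d) (wordBasis R n d) X ∈ schurAlgebra R n d := by
  rw [schurAlgebra, Subalgebra.mem_centralizer_iff]
  rintro _ ⟨a, rfl⟩
  induction a using MonoidAlgebra.induction_on with
  | of σ =>
    have h : (placePerm R n d).asAlgebraHom (MonoidAlgebra.of R _ σ) = placePerm R n d σ := by simp
    rw [h]
    refine (wordBasis R n d).ext fun j => ?_
    simp only [Module.End.mul_apply, placePerm_wordBasis, Matrix.toLin_self, map_sum, map_smul]
    refine Fintype.sum_equiv (Equiv.arrowCongr σ (Equiv.refl _)) _ _ fun i => ?_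
    have : (Equiv.arrowCongr σ (Equiv.refl _)) i = i ∘ ⇑σ⁻¹ := rfl
    rw [this, hX]
  | add a b ha hb => rw [map_add, add_mul, mul_add, ha, hb]
  | smul r a ha => rw [map_smul, smul_mul_assoc, mul_smul_comm, ha]

/-- The matrix, in the basis of words, of an endomorphism over the Schur algebra. -/
noncomputable def endMatrix (R : Type*) [CommRing R] (n d : ℕ) :
    Module.End (schurAlgebra R n d) (TensorSpace R n d) →ₗ[R]
      Matrix (Fin d → Fin n) (Fin d → Fin n) R where
  toFun f := LinearMap.toMatrix (wordBasis R n d) (wordBasis R n d) (f.restrictScalars R)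
  map_add' f g := by
    rw [← map_add]
    rfl
  map_smul' r f := by
    rw [RingHom.id_apply, ← map_smul]
    rfl

theorem endMatrix_injective (R : Type*) [CommRing R] (n d : ℕ) :
    Function.Injective (endMatrix R n d) := by
  intro f g h
  have := (LinearMap.toMatrix (wordBasis R n d) (wordBasis R n d)).injective h
  ext x
  exact LinearMap.congr_fun this x

theorem commutesWithInvariants_endMatrix (R : Type*) [CommRing R] (n d : ℕ)
    (f : Module.End (schurAlgebra R n d) (TensorSpace R n d)) :
    CommutesWithInvariants (endMatrix R n d f) := by
  intro X hX
  have hcomm : f.restrictScalars R ∘ₗ Matrix.toLin (wordBasis R n d) (wordBasis R n d) X =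
      Matrix.toLin (wordBasis R n d) (wordBasis R n d) X ∘ₗ f.restrictScalars R :=
    LinearMap.ext fun x => f.map_smul ⟨_, toLin_mem_schurAlgebra R n d X hX⟩ x
  have := congrArg (LinearMap.toMatrix (wordBasis R n d) (wordBasis R n d)) hcomm
  rwa [LinearMap.toMatrix_comp _ (wordBasis R n d), LinearMap.toMatrix_comp _ (wordBasis R n d),
    LinearMap.toMatrix_toLin] at this

theorem endMatrix_psi_single (R : Type*) [CommRing R] (n d : ℕ) (σ : Equiv.Perm (Fin d)) (r : R)
    (v w : Fin d → Fin n) :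
    endMatrix R n d (psi R n d (MonoidAlgebra.single σ r)) v w = if v ∘ σ = w then r else 0 := by
  have h : psi R n d (MonoidAlgebra.single σ r) = r • placePermEnd R n d σ := by
    simp [psi, MonoidAlgebra.lift_single]
  rw [h, map_smul, Matrix.smul_apply]
  have h2 : endMatrix R n d (placePermEnd R n d σ) v w = if v ∘ σ = w then 1 else 0 := by
    change LinearMap.toMatrix _ _ _ v w = _
    rw [LinearMap.toMatrix_apply]
    change (wordBasis R n d).repr (placePerm R n d σ (wordBasis R n d w)) v = _
    rw [placePerm_wordBasis, Module.Basis.repr_self, Finsupp.single_apply]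
    refine if_congr ⟨?_, ?_⟩ rfl rfl
    · rintro rfl
      funext k
      simp
    · rintro rfl
      funext k
      simp
  rw [h2]
  simp

/-! ### Entries at pairs of lattice words -/

/-- The pairs of lattice words of the same content. -/
abbrev LatticePair (n d : ℕ) : Type :=
  {x : Lex (Fin d → Fin n) × Lex (Fin d → Fin n) //
    IsLattice (ofLex x.1) ∧ IsLattice (ofLex x.2) ∧ content (ofLex x.1) = content (ofLex x.2)}

/-- The matrix entries of an endomorphism at the pairs of lattice words of the same content. -/
noncomputable def latticeEntries (R : Type*) [CommRing R] (n d : ℕ) :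
    Module.End (schurAlgebra R n d) (TensorSpace R n d) →ₗ[R] (LatticePair n d → R) where
  toFun f x := endMatrix R n d f (ofLex x.1.1) (ofLex x.1.2)
  map_add' f g := by
    funext x
    simp
  map_smul' r f := by
    funext x
    simp

theorem latticeEntries_injective (R : Type*) [CommRing R] (n d : ℕ) :
    Function.Injective (latticeEntries R n d) := by
  intro f g hfg
  refine endMatrix_injective R n d (sub_eq_zero.1 ?_)
  have hM := (commutesWithInvariants_endMatrix R n d f).sub
    (commutesWithInvariants_endMatrix R n d g)
  refine hM.eq_zero fun i j hi hj => ?_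
  by_cases h : content i = content j
  · exact sub_eq_zero.2 (congrFun hfg ⟨(toLex i, toLex j), hi, hj, h⟩)
  · exact hM.apply_eq_zero content content_comp h

theorem latticeEntries_comp_psi_surjective (R : Type*) [CommRing R] (n d : ℕ) :
    Function.Surjective (latticeEntries R n d ∘ₗ (psi R n d).toLinearMap) := by
  rw [← LinearMap.range_eq_top]
  have hex : ∀ x : LatticePair n d, ∃ p : Equiv.Perm (Fin d),
      (∀ k, ofLex x.1.1 (p k) = ofLex x.1.2 k) ∧
        ∀ k, colIdx (ofLex x.1.1) (p k) = colIdx (ofLex x.1.2) k :=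
    fun x => exists_perm_of_content_eq x.2.2.2
  choose p hp hc using hex
  refine eq_top_of_unitriangular
    (fun x y => signedColumnEntry R (p x) (ofLex x.1.2) (ofLex y.1.1) (ofLex y.1.2))
    (fun x => signedColumnEntry_self (hp x)) (fun x y h => Prod.mk_le_mk.2 ⟨?_, ?_⟩) _ fun x => ?_
  · exact x.2.1.toLex_le (columnInjective_left_of_signedColumnEntry_ne_zero (hc x) h)
  · exact x.2.2.1.toLex_le (columnInjective_of_signedColumnEntry_ne_zero h)
  · refine ⟨∑ c ∈ colStabilizer (ofLex x.1.2),
      MonoidAlgebra.single (p x * c) ((Equiv.Perm.sign c : ℤ) : R), ?_⟩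
    funext y
    rw [map_sum, Finset.sum_apply]
    refine Finset.sum_congr rfl fun c _ => ?_
    exact endMatrix_psi_single R n d _ _ _ _

end SchurWeyl

theorem mainTheorem4 {R : Type*} [CommRing R] (n d : ℕ) :
    Function.Surjective (SchurWeyl.psi R n d) := by
  intro f
  obtain ⟨a, ha⟩ := SchurWeyl.latticeEntries_comp_psi_surjective R n d
    (SchurWeyl.latticeEntries R n d f)
  exact ⟨a, SchurWeyl.latticeEntries_injective R n d ha⟩
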